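/- Let $\mathbf{C}^*$ be the category whose objects are the (complex, not necessarily unital) $C^*$-algebras and whose morphisms are the (not necessarily unital) $*$-homomorphisms. For $C^*$-algebras $A,B$ let $A\otimes B$ denote their maximal tensor product, i.e. the separated completion of the algebraic tensor product $A\odot B$ over $\mathbb{C}$ with respect to the largest $C^*$-seminorm on it; for $*$-homomorphisms $\varphi:A\to A'$ and $\psi:B\to B'$ let $\varphi\otimes\psi:A\otimes B\to A'\otimes B'$ be the continuous extension of $a\otimes b\mapsto\varphi(a)\otimes\psi(b)$. Let $\mathfrak{D}:\mathbf{C}^*\to\operatorname{End}(\mathbf{C}^*)$, where $\operatorname{End}(\mathbf{C}^*)$ is the category of endofunctors of $\mathbf{C}^*$ and natural transformations, be the functor sending $A$ to the endofunctor $\mathfrak{D}_A=A\otimes -$ (so $B\mapsto A\otimes B$, $\psi\mapsto \mathrm{id}_A\otimes\psi$) and sending $\varphi:A\to A'$ to the natural transformation $\mathfrak{D}_\varphi:\mathfrak{D}_A\Rightarrow\mathfrak{D}_{A'}$ with components $\varphi\otimes\mathrm{id}_B$. Theorem 3.19. The functor $\mathfrak{D}$ is full and faithful. That is, for all $C^*$-algebras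 $A,A'$ and every natural transformation $\Phi:\mathfrak{D}_A\Rightarrow\mathfrak{D}_{A'}$ there is a unique $*$-homomorphism $\varphi:A\to A'$ such that $\Phi_B=\varphi\otimes\mathrm{id}_B$ for every $C^*$-algebra $B$. -/

import Mathlib

open CategoryTheory
open scoped TensorProduct

universe u v

noncomputable section

/-! ### Completion of a seminormed `*`-algebra -/

/-- The (separated) completion of a seminormed space `α`, as a type of its own. -/
def StarCompletion (α : Type u) [SeminormedAddCommGroup α] : Type u := UniformSpace.Completion α

namespace StarCompletion

section AddCommGroup

variable {α : Type u} [SeminormedAddCommGroup α]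

instance instNormedAddCommGroup : NormedAddCommGroup (StarCompletion α) :=
  inferInstanceAs (NormedAddCommGroup (UniformSpace.Completion α))

instance : CompleteSpace (StarCompletion α) :=
  inferInstanceAs (CompleteSpace (UniformSpace.Completion α))

instance instNormedSpace [NormedSpace ℂ α] : NormedSpace ℂ (StarCompletion α) :=
  inferInstanceAs (NormedSpace ℂ (UniformSpace.Completion α))

/-- The canonical map from `α` to its completion. -/
def of (x : α) : StarCompletion α := UniformSpace.Completion.coe' x

theorem isDenseInducing_of : IsDenseInducing (of : α → StarCompletion α) :=
  UniformSpace.Completion.isDenseInducing_coe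

theorem continuous_of : Continuous (of : α → StarCompletion α) :=
  UniformSpace.Completion.continuous_coe α

theorem norm_of (x : α) : ‖of x‖ = ‖x‖ := UniformSpace.Completion.norm_coe x

theorem of_add (x y : α) : of (x + y) = of x + of y := UniformSpace.Completion.coe_add x y

theorem of_zero : of (0 : α) = 0 := UniformSpace.Completion.coe_zero

theorem of_smul [NormedSpace ℂ α] (c : ℂ) (x : α) : of (c • x) = c • of x :=
  UniformSpace.Completion.coe_smul c x

@[elab_as_elim]
theorem induction_on {P : StarCompletion α → Prop} (a : StarCompletion α)
    (hp : IsClosed {a | P a}) (ih : ∀ x : α, P (of x)) : P a :=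
  UniformSpace.Completion.induction_on a hp ih

end AddCommGroup

attribute [irreducible] instNormedSpace

section Ring

variable {α : Type u} [NonUnitalSeminormedRing α]

/-- Multiplication: the continuous extension of the multiplication of `α`. -/
@[irreducible]
def mul : StarCompletion α → StarCompletion α → StarCompletion α :=
  Function.curry <| (isDenseInducing_of.prodMap isDenseInducing_of).extend
    (of ∘ Function.uncurry (· * ·))

instance : Mul (StarCompletion α) := ⟨mul⟩

theorem of_mul (x y : α) : of (x * y) = of x * of y := by
  change _ = mul (of x) (of y)
  unfold mul
  exact ((isDenseInducing_of.prodMap isDenseInducing_of).extend_eq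
    (continuous_of.comp (@continuous_mul α _ _ _)) (x, y)).symm

instance : ContinuousMul (StarCompletion α) where
  continuous_mul := by
    let ι : α →+ StarCompletion α := { toFun := of, map_zero' := of_zero, map_add' := of_add }
    let m := (AddMonoidHom.mul : α →+ α →+ α).compr₂ ι
    have hm : Continuous fun q : α × α => m q.1 q.2 := continuous_of.comp continuous_mul
    have di : IsDenseInducing (ι : α → StarCompletion α) := isDenseInducing_of
    change Continuous fun q : StarCompletion α × StarCompletion α => mul q.1 q.2
    unfold mul
    exact (di.extend_Z_bilin di hm :)

instance : NonUnitalNormedRing (StarCompletion α) where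
  __ := (inferInstance : NormedAddCommGroup (StarCompletion α))
  zero_mul a := by
    induction a using induction_on with
    | hp => exact isClosed_eq (by fun_prop) continuous_const
    | ih a =>
    rw [← of_zero, ← of_mul, zero_mul]
  mul_zero a := by
    induction a using induction_on with
    | hp => exact isClosed_eq (by fun_prop) continuous_const
    | ih a =>
    rw [← of_zero, ← of_mul, mul_zero]
  mul_assoc a b c := by
    induction a using induction_on with
    | hp => exact isClosed_eq (by fun_prop) (by fun_prop)
    | ih a =>
    induction b using induction_on with
    | hp => exact isClosed_eq (by fun_prop) (by fun_prop)
    | ih b =>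
    induction c using induction_on with
    | hp => exact isClosed_eq (by fun_prop) (by fun_prop)
    | ih c =>
    simp only [← of_mul, mul_assoc]
  left_distrib a b c := by
    induction a using induction_on with
    | hp => exact isClosed_eq (by fun_prop) (by fun_prop)
    | ih a =>
    induction b using induction_on with
    | hp => exact isClosed_eq (by fun_prop) (by fun_prop)
    | ih b =>
    induction c using induction_on with
    | hp => exact isClosed_eq (by fun_prop) (by fun_prop)
    | ih c =>
    simp only [← of_mul, ← of_add, mul_add]
  right_distrib a b c := by
    induction a using induction_on with
    | hp => exact isClosed_eq (by fun_prop) (by fun_prop)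
    | ih a =>
    induction b using induction_on with
    | hp => exact isClosed_eq (by fun_prop) (by fun_prop)
    | ih b =>
    induction c using induction_on with
    | hp => exact isClosed_eq (by fun_prop) (by fun_prop)
    | ih c =>
    simp only [← of_mul, ← of_add, add_mul]
  norm_mul_le a b := by
    induction a using induction_on with
    | hp => exact isClosed_le (by fun_prop) (by fun_prop)
    | ih a =>
    induction b using induction_on with
    | hp => exact isClosed_le (by fun_prop) (by fun_prop)
    | ih b =>
    simpa only [← of_mul, norm_of] using _root_.norm_mul_le a b

instance [NormedSpace ℂ α] [IsScalarTower ℂ α α] :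
    IsScalarTower ℂ (StarCompletion α) (StarCompletion α) where
  smul_assoc c a b := by
    simp only [smul_eq_mul]
    induction a using induction_on with
    | hp => exact isClosed_eq (by fun_prop) (by fun_prop)
    | ih a =>
    induction b using induction_on with
    | hp => exact isClosed_eq (by fun_prop) (by fun_prop)
    | ih b =>
    simp only [← of_mul, ← of_smul, smul_mul_assoc]

instance [NormedSpace ℂ α] [SMulCommClass ℂ α α] :
    SMulCommClass ℂ (StarCompletion α) (StarCompletion α) where
  smul_comm c a b := by
    simp only [smul_eq_mul]
    induction a using induction_on with
    | hp => exact isClosed_eq (by fun_prop) (by fun_prop)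
    | ih a =>
    induction b using induction_on with
    | hp => exact isClosed_eq (by fun_prop) (by fun_prop)
    | ih b =>
    simp only [← of_mul, ← of_smul, mul_smul_comm]

end Ring

section Star

variable {α : Type u} [NonUnitalSeminormedRing α] [StarRing α] [NormedStarGroup α]

/-- The involution: the continuous extension of the involution of `α`. -/
@[irreducible]
def conj : StarCompletion α → StarCompletion α :=
  UniformSpace.Completion.map (star : α → α)

instance : Star (StarCompletion α) := ⟨conj⟩

theorem of_star (x : α) : of (star x) = star (of x) := by
  change _ = conj (of x)
  unfold conj
  exact (UniformSpace.Completion.map_coe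
    (starNormedAddGroupHom : NormedAddGroupHom α α).uniformContinuous x).symm

instance : ContinuousStar (StarCompletion α) where
  continuous_star := by
    change Continuous conj
    unfold conj
    exact UniformSpace.Completion.continuous_map

instance : StarRing (StarCompletion α) where
  star_involutive a := by
    induction a using induction_on with
    | hp => exact isClosed_eq (by fun_prop) (by fun_prop)
    | ih a =>
    rw [← of_star, ← of_star, star_star]
  star_add a b := by
    induction a using induction_on with
    | hp => exact isClosed_eq (by fun_prop) (by fun_prop)
    | ih a =>
    induction b using induction_on with
    | hp => exact isClosed_eq (by fun_prop) (by fun_prop)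
    | ih b =>
    simp only [← of_add, ← of_star, star_add]
  star_mul a b := by
    induction a using induction_on with
    | hp => exact isClosed_eq (by fun_prop) (by fun_prop)
    | ih a =>
    induction b using induction_on with
    | hp => exact isClosed_eq (by fun_prop) (by fun_prop)
    | ih b =>
    simp only [← of_mul, ← of_star, star_mul]

instance [NormedSpace ℂ α] [StarModule ℂ α] : StarModule ℂ (StarCompletion α) where
  star_smul c a := by
    induction a using induction_on with
    | hp => exact isClosed_eq (by fun_prop) (by fun_prop)
    | ih a =>
    simp only [← of_star, ← of_smul, star_smul]

end Star

section Map

/-- The continuous extension to the completions of a contraction. -/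
@[irreducible]
def extend {α β : Type u} [SeminormedAddCommGroup α] [SeminormedAddCommGroup β]
    (f : α → β) : StarCompletion α → StarCompletion β := UniformSpace.Completion.map f

theorem continuous_extend {α β : Type u} [SeminormedAddCommGroup α] [SeminormedAddCommGroup β]
    (f : α → β) : Continuous (extend f) := by
  unfold extend
  exact UniformSpace.Completion.continuous_map

theorem extend_of {α β : Type u} [NonUnitalSeminormedRing α] [StarRing α] [NormedSpace ℂ α]
    [NonUnitalSeminormedRing β] [StarRing β] [NormedSpace ℂ β] (f : α →⋆ₙₐ[ℂ] β) (hf : ∀ x, ‖f x‖ ≤ ‖x‖) (x : α) :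
    extend f (of x) = of (f x) := by
  unfold extend
  refine UniformSpace.Completion.map_coe (LipschitzWith.uniformContinuous (K := 1) ?_) x
  refine LipschitzWith.of_dist_le_mul fun x y => ?_
  rw [dist_eq_norm, dist_eq_norm, ← map_sub, NNReal.coe_one, one_mul]
  exact hf _

variable {α : Type u} [NonUnitalSeminormedRing α] [StarRing α] [NormedStarGroup α] [NormedSpace ℂ α]
variable {β : Type u} [NonUnitalSeminormedRing β] [StarRing β] [NormedStarGroup β] [NormedSpace ℂ β]

/-- The `*`-homomorphism between the completions induced by a contractive `*`-homomorphism. -/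
def map (f : α →⋆ₙₐ[ℂ] β) (hf : ∀ x, ‖f x‖ ≤ ‖x‖) : StarCompletion α →⋆ₙₐ[ℂ] StarCompletion β where
  toFun := extend f
  map_smul' c a := by
    have := continuous_extend f
    induction a using induction_on with
    | hp => exact isClosed_eq (by fun_prop) (by fun_prop)
    | ih a =>
    simp only [← of_smul, extend_of f hf, map_smul, MonoidHom.id_apply]
  map_zero' := by rw [← of_zero, extend_of f hf, map_zero, of_zero]
  map_add' a b := by
    have := continuous_extend f
    induction a using induction_on with
    | hp => exact isClosed_eq (by fun_prop) (by fun_prop)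
    | ih a =>
    induction b using induction_on with
    | hp => exact isClosed_eq (by fun_prop) (by fun_prop)
    | ih b =>
    simp only [← of_add, extend_of f hf, map_add]
  map_mul' a b := by
    have := continuous_extend f
    induction a using induction_on with
    | hp => exact isClosed_eq (by fun_prop) (by fun_prop)
    | ih a =>
    induction b using induction_on with
    | hp => exact isClosed_eq (by fun_prop) (by fun_prop)
    | ih b =>
    simp only [← of_mul, extend_of f hf, map_mul]
  map_star' a := by
    have := continuous_extend f
    induction a using induction_on with
    | hp => exact isClosed_eq (by fun_prop) (by fun_prop)
    | ih a =>
    simp only [← of_star, extend_of f hf, map_star]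

theorem map_of (f : α →⋆ₙₐ[ℂ] β) (hf : ∀ x, ‖f x‖ ≤ ‖x‖) (x : α) : map f hf (of x) = of (f x) :=
  extend_of f hf x

theorem continuous_map (f : α →⋆ₙₐ[ℂ] β) (hf : ∀ x, ‖f x‖ ≤ ‖x‖) : Continuous (map f hf) :=
  continuous_extend f

end Map

end StarCompletion

/-! ### C*-seminorms and the associated C*-completions -/

/-- A C*-seminorm on a complex `*`-algebra: a submultiplicative seminorm with `p (x* x) = p x ^ 2`. -/
structure CStarSeminorm (D : Type u) [NonUnitalRing D] [StarRing D] [Module ℂ D]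
    extends Seminorm ℂ D where
  mul_le' : ∀ x y : D, toFun (x * y) ≤ toFun x * toFun y
  star_mul_self' : ∀ x : D, toFun (star x * x) = toFun x ^ 2

namespace CStarSeminorm

section Basic

variable {D : Type u} [NonUnitalRing D] [StarRing D] [Module ℂ D]
variable {E : Type v} [NonUnitalRing E] [StarRing E] [Module ℂ E]

instance : CoeFun (CStarSeminorm D) (fun _ => D → ℝ) := ⟨fun p => p.toSeminorm⟩

theorem mul_le (p : CStarSeminorm D) (x y : D) : p (x * y) ≤ p x * p y := p.mul_le' x y

theorem star_mul_self (p : CStarSeminorm D) (x : D) : p (star x * x) = p x ^ 2 :=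
  p.star_mul_self' x

theorem nonneg (p : CStarSeminorm D) (x : D) : 0 ≤ p x := apply_nonneg p.toSeminorm x

theorem le_star (p : CStarSeminorm D) (x : D) : p x ≤ p (star x) := by
  by_contra! h
  have h1 := p.mul_le (star x) x
  rw [p.star_mul_self] at h1
  have h2 := p.nonneg (star x)
  nlinarith

theorem apply_star (p : CStarSeminorm D) (x : D) : p (star x) = p x :=
  le_antisymm (by simpa using p.le_star (star x)) (p.le_star x)

/-- The pull-back of a C*-seminorm along a `*`-homomorphism. -/
def comap (p : CStarSeminorm E) (f : D →⋆ₙₐ[ℂ] E) : CStarSeminorm D where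
  toFun x := p (f x)
  map_zero' := by simp [map_zero]
  add_le' x y := by simpa using map_add_le_add p.toSeminorm (f x) (f y)
  neg' x := by simp [map_neg_eq_map]
  smul' c x := by simp [map_smul_eq_mul]
  mul_le' x y := by simpa using p.mul_le (f x) (f y)
  star_mul_self' x := by simpa [map_star] using p.star_mul_self (f x)

theorem comap_apply (p : CStarSeminorm E) (f : D →⋆ₙₐ[ℂ] E) (x : D) : p.comap f x = p (f x) := rfl

end Basic

section Completion

variable {D : Type u} [NonUnitalRing D] [StarRing D] [Module ℂ D]

/-- The `*`-algebra `D`, regarded as a seminormed space by means of `p`. -/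
def Carrier (_p : CStarSeminorm D) : Type u := D

variable (p : CStarSeminorm D)

instance : NonUnitalRing p.Carrier := inferInstanceAs (NonUnitalRing D)
instance : StarRing p.Carrier := inferInstanceAs (StarRing D)
instance : Module ℂ p.Carrier := inferInstanceAs (Module ℂ D)
instance [h : StarModule ℂ D] : StarModule ℂ p.Carrier := h
instance [h : IsScalarTower ℂ D D] : IsScalarTower ℂ p.Carrier p.Carrier := h
instance [h : SMulCommClass ℂ D D] : SMulCommClass ℂ p.Carrier p.Carrier := h

instance : SeminormedAddCommGroup p.Carrier :=
  AddGroupSeminorm.toSeminormedAddCommGroup p.toSeminorm.toAddGroupSeminorm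

instance : NonUnitalSeminormedRing p.Carrier where
  __ := (inferInstance : SeminormedAddCommGroup p.Carrier)
  __ := (inferInstance : NonUnitalRing p.Carrier)
  norm_mul_le := p.mul_le

instance : NormedSpace ℂ p.Carrier where
  norm_smul_le c x := (map_smul_eq_mul p.toSeminorm c x).le

instance : NormedStarGroup p.Carrier where
  norm_star_le x := (p.apply_star x).le

/-- The C*-algebra generated by `(D, p)`: the (separated) completion of `D` with respect to `p`. -/
abbrev Completion : Type u := StarCompletion p.Carrier

instance : CStarRing p.Completion where
  norm_mul_self_le a := by
    induction a using StarCompletion.induction_on with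
    | hp => exact isClosed_le (by fun_prop) (by fun_prop)
    | ih a =>
    rw [← StarCompletion.of_star, ← StarCompletion.of_mul, StarCompletion.norm_of,
      StarCompletion.norm_of, ← sq]
    exact (p.star_mul_self a).ge

/-- The canonical `*`-homomorphism from `D` to its completion. -/
def toCompletion : D →⋆ₙₐ[ℂ] p.Completion where
  toFun x := StarCompletion.of (α := p.Carrier) x
  map_smul' := StarCompletion.of_smul (α := p.Carrier)
  map_zero' := StarCompletion.of_zero (α := p.Carrier)
  map_add' := StarCompletion.of_add (α := p.Carrier)
  map_mul' := StarCompletion.of_mul (α := p.Carrier)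
  map_star' := StarCompletion.of_star (α := p.Carrier)

theorem norm_toCompletion (x : D) : ‖p.toCompletion x‖ = p x :=
  StarCompletion.norm_of (α := p.Carrier) x

theorem denseRange_toCompletion : DenseRange p.toCompletion :=
  (StarCompletion.isDenseInducing_of (α := p.Carrier)).dense

variable [StarModule ℂ D] [IsScalarTower ℂ D D] [SMulCommClass ℂ D D]

instance : NonUnitalCStarAlgebra p.Completion where

end Completion

end CStarSeminorm

/-! ### The algebraic tensor product of C*-algebras -/

section AlgebraicTensor

variable {A B : Type u} [NonUnitalCStarAlgebra A] [NonUnitalCStarAlgebra B]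
variable {A' B' : Type u} [NonUnitalCStarAlgebra A'] [NonUnitalCStarAlgebra B']

/-- The involution on `A ⊗[ℂ] B` (`star (a ⊗ b) = star a ⊗ star b`) makes it a `*`-ring. -/
instance algTensorStarRing : StarRing (A ⊗[ℂ] B) where
  star_mul x y := by
    induction x with
    | zero => simp
    | add x₁ x₂ h₁ h₂ => simp only [add_mul, mul_add, star_add, h₁, h₂]
    | tmul a b =>
      induction y with
      | zero => simp
      | add y₁ y₂ h₁ h₂ => simp only [add_mul, mul_add, star_add, h₁, h₂]
      | tmul c d => simp
  star_add := star_add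

/-- The `*`-homomorphism `φ ⊗ ψ` between algebraic tensor products. -/
def algTensorMap (φ : A →⋆ₙₐ[ℂ] A') (ψ : B →⋆ₙₐ[ℂ] B') : A ⊗[ℂ] B →⋆ₙₐ[ℂ] A' ⊗[ℂ] B' where
  toFun := TensorProduct.map (φ : A →ₗ[ℂ] A') (ψ : B →ₗ[ℂ] B')
  map_smul' c x := map_smul _ c x
  map_zero' := map_zero _
  map_add' := map_add _
  map_mul' x y := by
    induction x with
    | zero => simp
    | add x₁ x₂ h₁ h₂ => simp only [add_mul, map_add, h₁, h₂]
    | tmul a b =>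
      induction y with
      | zero => simp
      | add y₁ y₂ h₁ h₂ => simp only [mul_add, map_add, h₁, h₂]
      | tmul c d => simp
  map_star' x := by
    induction x with
    | zero => simp
    | add x₁ x₂ h₁ h₂ => simp only [star_add, map_add, h₁, h₂]
    | tmul a b => simp [map_star]

@[simp]
theorem algTensorMap_tmul (φ : A →⋆ₙₐ[ℂ] A') (ψ : B →⋆ₙₐ[ℂ] B') (a : A) (b : B) :
    algTensorMap φ ψ (a ⊗ₜ[ℂ] b) = φ a ⊗ₜ[ℂ] ψ b := rfl

/-- The flip `a ⊗ b ↦ b ⊗ a`. -/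
def algTensorComm : A ⊗[ℂ] B →⋆ₙₐ[ℂ] B ⊗[ℂ] A where
  toFun := TensorProduct.comm ℂ A B
  map_smul' c x := map_smul _ c x
  map_zero' := map_zero _
  map_add' := map_add _
  map_mul' x y := by
    induction x with
    | zero => simp
    | add x₁ x₂ h₁ h₂ => simp only [add_mul, map_add, h₁, h₂]
    | tmul a b =>
      induction y with
      | zero => simp
      | add y₁ y₂ h₁ h₂ => simp only [mul_add, map_add, h₁, h₂]
      | tmul c d => simp
  map_star' x := by
    induction x with
    | zero => simp
    | add x₁ x₂ h₁ h₂ => simp only [star_add, map_add, h₁, h₂]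
    | tmul a b => simp

end AlgebraicTensor

/-! ### Every C*-seminorm on `A ⊗[ℂ] B` satisfies `p (a ⊗ b) ≤ ‖a‖ * ‖b‖` -/

section Bound

variable {A B : Type u} [NonUnitalCStarAlgebra A] [NonUnitalCStarAlgebra B]

/-- Left multiplication on `A` by an element of its unitization. -/
def unitizationMulLeft (c : Unitization ℂ A) : A →ₗ[ℂ] A where
  toFun a := c.fst • a + c.snd * a
  map_add' a b := by simp only [smul_add, mul_add]; abel
  map_smul' r a := by simp only [smul_add, mul_smul_comm, smul_comm r, RingHom.id_apply]

theorem inr_unitizationMulLeft (c : Unitization ℂ A) (a : A) :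
    (unitizationMulLeft c a : Unitization ℂ A) = c * a := by
  ext <;> simp [unitizationMulLeft]

theorem star_unitizationMulLeft_mul (c : Unitization ℂ A) (a a' : A) :
    star (unitizationMulLeft c a) * unitizationMulLeft c a' =
      star a * unitizationMulLeft (star c * c) a' := by
  apply Unitization.inr_injective (R := ℂ)
  simp only [Unitization.inr_mul, Unitization.inr_star, inr_unitizationMulLeft, star_mul, mul_assoc]

theorem star_rTensor_mul (c : Unitization ℂ A) (w w' : A ⊗[ℂ] B) :
    star ((unitizationMulLeft c).rTensor B w) * (unitizationMulLeft c).rTensor B w' =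
      star w * (unitizationMulLeft (star c * c)).rTensor B w' := by
  induction w with
  | zero => simp
  | add x₁ x₂ h₁ h₂ => simp only [add_mul, star_add, map_add, h₁, h₂]
  | tmul a b =>
    induction w' with
    | zero => simp
    | add y₁ y₂ h₁ h₂ => simp only [mul_add, map_add, h₁, h₂]
    | tmul a' b' => simp [star_unitizationMulLeft_mul]

theorem CStarSeminorm.rTensor_le (p : CStarSeminorm (A ⊗[ℂ] B)) (a : A) (w : A ⊗[ℂ] B) :
    p ((unitizationMulLeft (a : Unitization ℂ A)).rTensor B w) ≤ ‖a‖ * p w := by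
  let _ : PartialOrder (Unitization ℂ A) := CStarAlgebra.spectralOrder _
  let _ : StarOrderedRing (Unitization ℂ A) := CStarAlgebra.spectralOrderedRing _
  let _ : PartialOrder p.Completion := CStarAlgebra.spectralOrder _
  let _ : StarOrderedRing p.Completion := CStarAlgebra.spectralOrderedRing _
  have h0 : star (a : Unitization ℂ A) * a ≤ algebraMap ℝ _ (‖(a : Unitization ℂ A)‖ ^ 2) :=
    CStarAlgebra.star_mul_le_algebraMap_norm_sq
  rw [Unitization.norm_inr] at h0
  obtain ⟨c, hc⟩ := CStarAlgebra.nonneg_iff_eq_star_mul_self.mp (sub_nonneg.mpr h0)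
  set La := (unitizationMulLeft (a : Unitization ℂ A)).rTensor B with hLa
  set Lc := (unitizationMulLeft c).rTensor B with hLc
  have key : star (Lc w) * Lc w = (‖a‖ ^ 2 : ℂ) • (star w * w) - star (La w) * La w := by
    rw [hLc, hLa, star_rTensor_mul, star_rTensor_mul, ← hc, ← mul_smul_comm, ← mul_sub]
    congr 1
    have : unitizationMulLeft (algebraMap ℝ (Unitization ℂ A) (‖a‖ ^ 2) - star (a : Unitization ℂ A) * (a : Unitization ℂ A)) =
        (‖a‖ ^ 2 : ℂ) • LinearMap.id - unitizationMulLeft (star (a : Unitization ℂ A) * (a : Unitization ℂ A)) := by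
      ext x
      apply Unitization.inr_injective (R := ℂ)
      rw [inr_unitizationMulLeft]
      simp [sub_mul, inr_unitizationMulLeft, Algebra.algebraMap_eq_smul_one]
      rw [← Complex.coe_smul, Complex.ofReal_pow]
    rw [this]
    simp [LinearMap.rTensor_sub, LinearMap.rTensor_smul]
  have h1 := star_mul_self_nonneg (p.toCompletion (Lc w))
  rw [← map_star, ← map_mul, key, map_sub, sub_nonneg] at h1
  have h2 := CStarAlgebra.norm_le_norm_of_nonneg_of_le
    (by rw [map_mul, map_star]; exact star_mul_self_nonneg _) h1
  rw [map_smul, norm_smul, norm_toCompletion, norm_toCompletion, p.star_mul_self,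
    p.star_mul_self] at h2
  have h3 : p (La w) ^ 2 ≤ (‖a‖ * p w) ^ 2 := by
    rw [mul_pow]; simpa using h2
  exact le_of_sq_le_sq h3 (mul_nonneg (norm_nonneg _) (p.nonneg _))

theorem CStarSeminorm.mul_tmul_le (p : CStarSeminorm (A ⊗[ℂ] B)) (a a' : A) (b : B) :
    p ((a * a') ⊗ₜ[ℂ] b) ≤ ‖a‖ * p (a' ⊗ₜ[ℂ] b) := by
  simpa [unitizationMulLeft] using p.rTensor_le a (a' ⊗ₜ[ℂ] b)

theorem CStarSeminorm.tmul_mul_le (p : CStarSeminorm (A ⊗[ℂ] B)) (a : A) (b b' : B) :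
    p (a ⊗ₜ[ℂ] (b * b')) ≤ ‖b‖ * p (a ⊗ₜ[ℂ] b') :=
  (p.comap algTensorComm).mul_tmul_le b b' a

theorem CStarSeminorm.tmul_le (p : CStarSeminorm (A ⊗[ℂ] B)) (a : A) (b : B) :
    p (a ⊗ₜ[ℂ] b) ≤ ‖a‖ * ‖b‖ := by
  have h1 : p (a ⊗ₜ[ℂ] b) ^ 2 ≤ ‖a‖ * ‖b‖ * p (a ⊗ₜ[ℂ] b) := by
    rw [← p.star_mul_self]
    calc p (star (a ⊗ₜ[ℂ] b) * a ⊗ₜ[ℂ] b) = p ((star a * a) ⊗ₜ[ℂ] (star b * b)) := by simp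
      _ ≤ ‖star a‖ * p (a ⊗ₜ[ℂ] (star b * b)) := p.mul_tmul_le _ _ _
      _ ≤ ‖star a‖ * (‖star b‖ * p (a ⊗ₜ[ℂ] b)) := by gcongr; exact p.tmul_mul_le _ _ _
      _ = ‖a‖ * ‖b‖ * p (a ⊗ₜ[ℂ] b) := by rw [norm_star, norm_star]; ring
  rcases (p.nonneg (a ⊗ₜ[ℂ] b)).eq_or_lt with h | h
  · rw [← h]; positivity
  · rw [sq] at h1; exact le_of_mul_le_mul_right h1 h

/-- The values of the C*-seminorms at a fixed element of `A ⊗[ℂ] B` are bounded. -/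
theorem bddAbove_cstarSeminorm (x : A ⊗[ℂ] B) :
    BddAbove (Set.range fun p : CStarSeminorm (A ⊗[ℂ] B) => p x) := by
  suffices h : ∃ C : ℝ, ∀ p : CStarSeminorm (A ⊗[ℂ] B), p x ≤ C by
    obtain ⟨C, hC⟩ := h
    exact ⟨C, by rintro _ ⟨p, rfl⟩; exact hC p⟩
  induction x with
  | zero => exact ⟨0, fun p => (map_zero p.toSeminorm).le⟩
  | tmul a b => exact ⟨_, fun p => p.tmul_le a b⟩
  | add x y hx hy =>
    obtain ⟨C, hC⟩ := hx
    obtain ⟨C', hC'⟩ := hy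
    exact ⟨C + C', fun p => (map_add_le_add p.toSeminorm x y).trans (add_le_add (hC p) (hC' p))⟩

end Bound

/-! ### The maximal tensor product -/

section MaxTensor

variable (A B : Type u) [NonUnitalCStarAlgebra A] [NonUnitalCStarAlgebra B]

instance : Nonempty (CStarSeminorm (A ⊗[ℂ] B)) :=
  ⟨{ toSeminorm := 0
     mul_le' := fun _ _ => (zero_mul (0 : ℝ)).ge
     star_mul_self' := fun _ => (zero_pow (M₀ := ℝ) two_ne_zero).symm }⟩

/-- The maximal C*-seminorm on `A ⊗[ℂ] B`: the supremum of all C*-seminorms. -/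
def maxCStarSeminorm : CStarSeminorm (A ⊗[ℂ] B) where
  toFun x := ⨆ p : CStarSeminorm (A ⊗[ℂ] B), p x
  map_zero' := by simp
  add_le' x y := ciSup_le fun p => (map_add_le_add p.toSeminorm x y).trans
    (add_le_add (le_ciSup (bddAbove_cstarSeminorm x) p) (le_ciSup (bddAbove_cstarSeminorm y) p))
  neg' x := by simp
  smul' c x := by
    simp only [map_smul_eq_mul]
    exact (Real.mul_iSup_of_nonneg (norm_nonneg c) _).symm
  mul_le' x y := ciSup_le fun p => (p.mul_le x y).trans
    (mul_le_mul (le_ciSup (bddAbove_cstarSeminorm x) p) (le_ciSup (bddAbove_cstarSeminorm y) p)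
      (p.nonneg y) (Real.iSup_nonneg fun q => q.nonneg x))
  star_mul_self' x := by
    have h0 : 0 ≤ ⨆ p : CStarSeminorm (A ⊗[ℂ] B), p x := Real.iSup_nonneg fun q => q.nonneg x
    refine le_antisymm (ciSup_le fun p => ?_) ?_
    · rw [p.star_mul_self]
      exact pow_le_pow_left₀ (p.nonneg x) (le_ciSup (bddAbove_cstarSeminorm x) p) 2
    · refine (Real.le_sqrt h0 (Real.iSup_nonneg fun q => q.nonneg _)).mp (ciSup_le fun p => ?_)
      refine Real.le_sqrt_of_sq_le ?_
      rw [← p.star_mul_self]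
      exact le_ciSup (bddAbove_cstarSeminorm (star x * x)) p

variable {A B} in
theorem le_maxCStarSeminorm (p : CStarSeminorm (A ⊗[ℂ] B)) (x : A ⊗[ℂ] B) :
    p x ≤ maxCStarSeminorm A B x :=
  le_ciSup (bddAbove_cstarSeminorm x) p

/-- The maximal tensor product `A ⊗_max B`: the completion of `A ⊗[ℂ] B` with respect to the
largest C*-seminorm. -/
abbrev MaxTensor : Type u := (maxCStarSeminorm A B).Completion

namespace MaxTensor

variable {A B}
variable {A' B' : Type u} [NonUnitalCStarAlgebra A'] [NonUnitalCStarAlgebra B']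
variable {A'' B'' : Type u} [NonUnitalCStarAlgebra A''] [NonUnitalCStarAlgebra B'']

/-- The canonical `*`-homomorphism from the algebraic to the maximal tensor product. -/
def ofAlg : A ⊗[ℂ] B →⋆ₙₐ[ℂ] MaxTensor A B := (maxCStarSeminorm A B).toCompletion

theorem denseRange_ofAlg : DenseRange (ofAlg : A ⊗[ℂ] B → MaxTensor A B) :=
  (maxCStarSeminorm A B).denseRange_toCompletion

/-- The `*`-homomorphism `φ ⊗ ψ : A ⊗_max B → A' ⊗_max B'`, that is, the continuous extension of
`a ⊗ b ↦ φ a ⊗ ψ b`. -/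
def map (φ : A →⋆ₙₐ[ℂ] A') (ψ : B →⋆ₙₐ[ℂ] B') : MaxTensor A B →⋆ₙₐ[ℂ] MaxTensor A' B' :=
  StarCompletion.map (α := (maxCStarSeminorm A B).Carrier) (β := (maxCStarSeminorm A' B').Carrier)
    (algTensorMap φ ψ)
    (fun x => le_maxCStarSeminorm ((maxCStarSeminorm A' B').comap (algTensorMap φ ψ)) x)

theorem continuous_map (φ : A →⋆ₙₐ[ℂ] A') (ψ : B →⋆ₙₐ[ℂ] B') : Continuous (map φ ψ) :=
  StarCompletion.continuous_map _ _

theorem map_ofAlg (φ : A →⋆ₙₐ[ℂ] A') (ψ : B →⋆ₙₐ[ℂ] B') (x : A ⊗[ℂ] B) :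
    map φ ψ (ofAlg x) = ofAlg (algTensorMap φ ψ x) :=
  StarCompletion.map_of (α := (maxCStarSeminorm A B).Carrier)
    (β := (maxCStarSeminorm A' B').Carrier) _ _ x

theorem hom_ext {C : Type u} [NonUnitalCStarAlgebra C] {f g : MaxTensor A B →⋆ₙₐ[ℂ] C}
    (hf : Continuous f) (hg : Continuous g)
    (h : ∀ a b, f (ofAlg (a ⊗ₜ[ℂ] b)) = g (ofAlg (a ⊗ₜ[ℂ] b))) : f = g := by
  refine DFunLike.coe_injective (denseRange_ofAlg.equalizer hf hg (funext fun x => ?_))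
  simp only [Function.comp_apply]
  induction x with
  | zero => simp
  | tmul a b => exact h a b
  | add x y hx hy => simp only [map_add, hx, hy]

theorem map_id : map (NonUnitalStarAlgHom.id ℂ A) (NonUnitalStarAlgHom.id ℂ B) =
    NonUnitalStarAlgHom.id ℂ (MaxTensor A B) :=
  hom_ext (continuous_map _ _) continuous_id fun a b => by rw [map_ofAlg]; simp

theorem map_comp (φ' : A' →⋆ₙₐ[ℂ] A'') (φ : A →⋆ₙₐ[ℂ] A') (ψ' : B' →⋆ₙₐ[ℂ] B'')
    (ψ : B →⋆ₙₐ[ℂ] B') : map (φ'.comp φ) (ψ'.comp ψ) = (map φ' ψ').comp (map φ ψ) :=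
  hom_ext (continuous_map _ _) ((continuous_map _ _).comp (continuous_map _ _)) fun a b => by
    simp [map_ofAlg]

end MaxTensor

end MaxTensor

/-! ### The category of C*-algebras and the tensor embedding -/

/-- The category of (not necessarily unital) C*-algebras and `*`-homomorphisms. -/
structure CStarAlgCat : Type (u + 1) where
  carrier : Type u
  [isCStarAlgebra : NonUnitalCStarAlgebra carrier]

namespace CStarAlgCat

instance : CoeSort CStarAlgCat.{u} (Type u) := ⟨carrier⟩

instance (A : CStarAlgCat.{u}) : NonUnitalCStarAlgebra A := A.isCStarAlgebra

/-- Morphisms of C*-algebras are the (not necessarily unital) `*`-homomorphisms. -/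
@[ext]
structure Hom (A B : CStarAlgCat.{u}) : Type u where
  hom : A →⋆ₙₐ[ℂ] B

instance : Category CStarAlgCat.{u} where
  Hom A B := Hom A B
  id A := ⟨NonUnitalStarAlgHom.id ℂ A⟩
  comp f g := ⟨g.hom.comp f.hom⟩

@[ext]
theorem hom_ext {A B : CStarAlgCat.{u}} {f g : A ⟶ B} (h : f.hom = g.hom) : f = g := Hom.ext h

@[simp]
theorem id_hom (A : CStarAlgCat.{u}) : (𝟙 A : A ⟶ A).hom = NonUnitalStarAlgHom.id ℂ A := rfl

@[simp]
theorem comp_hom {A B C : CStarAlgCat.{u}} (f : A ⟶ B) (g : B ⟶ C) :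
    (f ≫ g).hom = g.hom.comp f.hom := rfl

/-- The endofunctor `A ⊗_max -`, which sends `ψ : B → B'` to `id_A ⊗ ψ`. -/
def tensorLeft (A : CStarAlgCat.{u}) : CStarAlgCat.{u} ⥤ CStarAlgCat.{u} where
  obj B := ⟨MaxTensor A B⟩
  map ψ := ⟨MaxTensor.map (NonUnitalStarAlgHom.id ℂ A) ψ.hom⟩
  map_id _ := hom_ext MaxTensor.map_id
  map_comp ψ ψ' := hom_ext
    (MaxTensor.map_comp (NonUnitalStarAlgHom.id ℂ A) (NonUnitalStarAlgHom.id ℂ A) ψ'.hom ψ.hom)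

/-- The tensor embedding: it sends a C*-algebra `A` to the endofunctor `A ⊗_max -`, and a
`*`-homomorphism `φ` to the natural transformation with components `φ ⊗ id_B`. -/
def tensorEmbedding : CStarAlgCat.{u} ⥤ (CStarAlgCat.{u} ⥤ CStarAlgCat.{u}) where
  obj A := tensorLeft A
  map φ :=
    { app := fun B => ⟨MaxTensor.map φ.hom (NonUnitalStarAlgHom.id ℂ B)⟩
      naturality := fun B B' ψ => hom_ext <|
        (MaxTensor.map_comp φ.hom (NonUnitalStarAlgHom.id ℂ _)
          (NonUnitalStarAlgHom.id ℂ B') ψ.hom).symm.trans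
        (MaxTensor.map_comp (NonUnitalStarAlgHom.id ℂ _) φ.hom ψ.hom
          (NonUnitalStarAlgHom.id ℂ B)) }
  map_id A := by
    ext B : 2
    exact hom_ext MaxTensor.map_id
  map_comp φ φ' := by
    ext B : 2
    exact hom_ext (MaxTensor.map_comp φ'.hom φ.hom (NonUnitalStarAlgHom.id ℂ B)
      (NonUnitalStarAlgHom.id ℂ B))

end CStarAlgCat

end

/-! Naturality leaves a transformation `Φ` no freedom beyond its component at `ℂ`. Since `A ⊗ ℂ ≅ A`
(`tmulOneEquiv`), that component is a `*`-homomorphism `φ : A → A'`. It determines `Φ` in two steps.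

For `B = C₀((0, 1])`, naturality along the evaluations shows that `Φ (a ⊗ f)` and `φ a ⊗ f` both
have the value `f t • φ a` at every `t`. By `eq_zero_of_map_eval` they are equal. For general `B`,
functional calculus makes each positive contraction `b` the image of the coordinate function
(`exists_hom_coord_eq`), so naturality gives `Φ (a ⊗ b) = φ a ⊗ b`. Positive contractions span `B`,
and density and continuity do the rest.

The analytic core is `eq_zero_of_map_eval`: the maximal norm on `A ⊙ C₀((0, 1])` sees nothing beyond
values at points. A self-adjoint algebraic tensor `w` with all values at most `ε` in norm is the
limit of its Bernstein sums `∑ w(k/n) ⊗ bₖ`. As `bₖ ≥ 0` and `∑ bₖ ≤ 1`, such a sum ought to lie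
between `-ε` and `ε`. Without a unit this makes sense only after conjugation by `d ⊗ e`, where `d* d
⊗ e* e` replaces `1`; the result is a bound proportional to `ε` (`norm_conj_le`). -/

noncomputable section

open scoped unitInterval ContinuousMapZero

/-! ### Functions on the unit interval that vanish at zero -/

/-- The C*-algebra `C₀((0, 1])`, realised in an arbitrary universe as the algebra of continuous
functions on the unit interval which vanish at zero. -/
abbrev IntervalAlgebra : Type u := C(ULift.{u} I, ℂ)₀

/-- A copy of the C*-algebra of complex numbers in an arbitrary universe. -/
abbrev ScalarAlgebra : Type u := C(PUnit.{u + 1}, ℂ)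

namespace IntervalAlgebra

instance : NonUnitalCStarAlgebra IntervalAlgebra.{u} where

/-- Evaluation at a point, with values in the copy `ScalarAlgebra` of `ℂ`. -/
def eval (t : ULift.{u} I) : IntervalAlgebra.{u} →⋆ₙₐ[ℂ] ScalarAlgebra.{u} where
  toFun f := ContinuousMap.const _ (f t)
  map_smul' _ _ := rfl
  map_zero' := rfl
  map_add' _ _ := rfl
  map_mul' _ _ := rfl
  map_star' _ := rfl

theorem norm_le_of_forall {f : IntervalAlgebra.{u}} {r : ℝ} (hr : 0 ≤ r) (h : ∀ t, ‖f t‖ ≤ r) :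
    ‖f‖ ≤ r := by
  rw [ContinuousMapZero.norm_def]
  exact (ContinuousMap.norm_le _ hr).2 h

/-- The square root of a Bernstein polynomial that vanishes at zero. -/
def sqrtBernstein (n k : ℕ) : IntervalAlgebra.{u} where
  -- The shift to `k + 1` omits the zeroth polynomial, which is `1` at zero and so does not belong
  -- to the algebra.
  toFun t := (√(bernstein n (k + 1) t.down) : ℝ)
  continuous_toFun := by fun_prop
  map_zero' := by simp [bernstein_apply]

theorem sqrtBernstein_apply (n k : ℕ) (t : ULift.{u} I) :
    sqrtBernstein n k t = (√(bernstein n (k + 1) t.down) : ℝ) := rfl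

/-- Writing the polynomials as `star s * s` lets positivity pass to elementary tensors, in
`ofAlg_tmul_star_mul_self_nonneg`. -/
theorem star_sqrtBernstein_mul_self_apply (n k : ℕ) (t : ULift.{u} I) :
    (star (sqrtBernstein n k) * sqrtBernstein n k) t = (bernstein n (k + 1) t.down : ℂ) := by
  change star (sqrtBernstein n k t) * sqrtBernstein n k t = _
  rw [sqrtBernstein_apply, Complex.star_def, Complex.conj_ofReal, ← Complex.ofReal_mul,
    Real.mul_self_sqrt bernstein_nonneg]

/-- The points `(k + 1) / n` of the unit interval. -/
def node {n : ℕ} (k : Fin n) : ULift.{u} I := ⟨bernstein.z k.succ⟩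

theorem sum_apply {ι : Type*} (s : Finset ι) (f : ι → IntervalAlgebra.{u}) (t : ULift.{u} I) :
    (∑ i ∈ s, f i) t = ∑ i ∈ s, f i t :=
  map_sum (ContinuousMapZero.evalCLM ℂ t) f s

/-- Bernstein's form of the Weierstrass theorem; the omitted zeroth term has coefficient `f 0 = 0`.
-/
theorem tendsto_bernstein (f : IntervalAlgebra.{u}) :
    Filter.Tendsto (fun n : ℕ => ∑ k : Fin n,
      f (node k) • (star (sqrtBernstein n k) * sqrtBernstein n k)) Filter.atTop (nhds f) := by
  let g : C(I, ℂ) := ⟨fun t => f ⟨t⟩, by fun_prop⟩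
  have hg := bernsteinApproximation_uniform g
  rw [tendsto_iff_norm_sub_tendsto_zero] at hg ⊢
  refine squeeze_zero (fun _ => norm_nonneg _) (fun n => ?_) hg
  refine norm_le_of_forall (norm_nonneg _) fun t => ?_
  refine le_trans (le_of_eq ?_) (ContinuousMap.norm_coe_le_norm _ t.down)
  have h0 : f ⟨bernstein.z (0 : Fin (n + 1))⟩ = 0 := by
    rw [bernstein.z_zero]; exact map_zero f
  change ‖(∑ k : Fin n, f (node k) • (star (sqrtBernstein n k) * sqrtBernstein n k)) t - f t‖ =
    ‖bernsteinApproximation n g t.down - f t‖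
  rw [bernsteinApproximation.apply, Fin.sum_univ_succ, sum_apply]
  change _ = ‖bernstein n 0 t.down • f ⟨bernstein.z (0 : Fin (n + 1))⟩ + _ - _‖
  rw [h0, smul_zero, zero_add]
  congr 2
  refine Finset.sum_congr rfl fun k _ => ?_
  change f (node k) * ((star (sqrtBernstein n k) * sqrtBernstein n k) t) = _
  rw [star_sqrtBernstein_mul_self_apply, Complex.real_smul, mul_comm]
  rfl

/-- The Bernstein polynomials form a partition of unity, from which one nonnegative member is
missing here. -/
theorem norm_sum_bernstein_le (n : ℕ) :
    ‖∑ k : Fin n, star (sqrtBernstein.{u} n k) * sqrtBernstein n k‖ ≤ 1 := by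
  refine norm_le_of_forall zero_le_one fun t => ?_
  have h := bernstein.probability n t.down
  rw [Fin.sum_univ_succ] at h
  simp only [sum_apply, star_sqrtBernstein_mul_self_apply]
  rw [← Complex.ofReal_sum, Complex.norm_real, Real.norm_of_nonneg
    (Finset.sum_nonneg fun k _ => bernstein_nonneg), ← h]
  exact le_add_of_nonneg_left bernstein_nonneg

/-- The identity function of the unit interval. -/
def coord : IntervalAlgebra.{u} where
  toFun t := (t.down : ℝ)
  continuous_toFun := by fun_prop
  map_zero' := by simp

/-- Positive contractions are images of the identity function under `*`-homomorphisms. -/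
theorem exists_hom_coord_eq {B : Type u} [NonUnitalCStarAlgebra B] [PartialOrder B]
    [StarOrderedRing B] {b : B} (hb : 0 ≤ b) (hb1 : ‖b‖ ≤ 1) :
    ∃ ψ : IntervalAlgebra.{u} →⋆ₙₐ[ℂ] B, ψ coord = b := by
  have hsa : IsStarNormal b := (IsSelfAdjoint.of_nonneg hb).isStarNormal
  -- The quasispectrum of a positive contraction lies in `[0, 1]`, so this retraction is the
  -- inclusion there. Hence `coord` pulls back to the identity function, which functional calculus
  -- sends to `b`.
  let q : C(quasispectrum ℂ b, ULift.{u} I)₀ :=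
    { toFun := fun z => ⟨Set.projIcc 0 1 zero_le_one (z : ℂ).re⟩
      continuous_toFun := by fun_prop
      map_zero' := by
        change ULift.up _ = ULift.up _
        congr 1
        exact Set.projIcc_left (zero_le_one' ℝ) }
  refine ⟨(cfcₙHom hsa).comp (ContinuousMapZero.nonUnitalStarAlgHom_precomp ℂ q), ?_⟩
  have h : ContinuousMapZero.nonUnitalStarAlgHom_precomp ℂ q coord =
      ContinuousMapZero.id (quasispectrum ℂ b) := by
    ext ⟨z, hz⟩
    rw [← (IsSelfAdjoint.of_nonneg hb).quasispectrumRestricts.algebraMap_image] at hz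
    obtain ⟨x, hx, rfl⟩ := hz
    have hx0 : 0 ≤ x := quasispectrum_nonneg_of_nonneg b hb x hx
    have hx1 : x ≤ 1 :=
      (le_abs_self x).trans ((NonUnitalIsometricContinuousFunctionalCalculus.norm_quasispectrum_le b hx
        (IsSelfAdjoint.of_nonneg hb)).trans hb1)
    change (((Set.projIcc (0 : ℝ) 1 zero_le_one x : I) : ℝ) : ℂ) = (x : ℂ)
    rw [Set.projIcc_of_mem zero_le_one ⟨hx0, hx1⟩]
  rw [NonUnitalStarAlgHom.comp_apply, h, cfcₙHom_id]

end IntervalAlgebra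

/-! ### Tensoring with the complex numbers -/

namespace MaxTensor

variable {A B : Type u} [NonUnitalCStarAlgebra A] [NonUnitalCStarAlgebra B]

theorem norm_ofAlg_tmul_le (a : A) (b : B) : ‖ofAlg (a ⊗ₜ[ℂ] b)‖ ≤ ‖a‖ * ‖b‖ :=
  ((maxCStarSeminorm A B).norm_toCompletion _).trans_le ((maxCStarSeminorm A B).tmul_le a b)

/-- The norm of `A` pulled back along `f` is a C*-seminorm, hence dominated by the maximal one. -/
theorem norm_map_ofAlg_le (f : A ⊗[ℂ] B →⋆ₙₐ[ℂ] A) (w : A ⊗[ℂ] B) : ‖f w‖ ≤ ‖ofAlg w‖ := by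
  let q : CStarSeminorm A :=
    { toSeminorm := normSeminorm ℂ A
      mul_le' := norm_mul_le
      star_mul_self' := fun x => (CStarRing.norm_star_mul_self (x := x)).trans (sq _).symm }
  exact (le_maxCStarSeminorm (q.comap f) w).trans_eq
    ((maxCStarSeminorm A B).norm_toCompletion w).symm

/-- Slicing with a linear functional on the second factor. -/
def slice (A : Type u) [NonUnitalCStarAlgebra A] (χ : B →ₗ[ℂ] ℂ) : A ⊗[ℂ] B →ₗ[ℂ] A :=
  (TensorProduct.rid ℂ A).toLinearMap ∘ₗ χ.lTensor A

@[simp]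
theorem slice_tmul (χ : B →ₗ[ℂ] ℂ) (a : A) (b : B) : slice A χ (a ⊗ₜ[ℂ] b) = χ b • a := by
  simp [slice]

/-- The slice map of a character is a `*`-homomorphism. -/
def sliceHom (A : Type u) [NonUnitalCStarAlgebra A] (χ : B →⋆ₙₐ[ℂ] ℂ) : A ⊗[ℂ] B →⋆ₙₐ[ℂ] A where
  toFun := slice A (χ : B →ₗ[ℂ] ℂ)
  map_smul' c x := map_smul _ c x
  map_zero' := map_zero _
  map_add' := map_add _
  map_mul' x y := by
    induction x with
    | zero => simp
    | add x₁ x₂ h₁ h₂ => simp only [add_mul, map_add, h₁, h₂]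
    | tmul a b =>
      induction y with
      | zero => simp
      | add y₁ y₂ h₁ h₂ => simp only [mul_add, map_add, h₁, h₂]
      | tmul c d => simp [smul_mul_smul_comm]
  map_star' x := by
    induction x with
    | zero => simp
    | add x₁ x₂ h₁ h₂ => simp only [star_add, map_add, h₁, h₂]
    | tmul a b => simp [map_star]

@[simp]
theorem sliceHom_tmul (χ : B →⋆ₙₐ[ℂ] ℂ) (a : A) (b : B) :
    sliceHom A χ (a ⊗ₜ[ℂ] b) = χ b • a := slice_tmul _ a b

/-- The evaluation isomorphism, as a character. -/
def scalarChar : ScalarAlgebra.{u} →⋆ₙₐ[ℂ] ℂ where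
  toFun f := f PUnit.unit
  map_smul' _ _ := rfl
  map_zero' := rfl
  map_add' _ _ := rfl
  map_mul' _ _ := rfl
  map_star' _ := rfl

/-- The embedding `a ↦ a ⊗ 1`. -/
def tmulOne (A : Type u) [NonUnitalCStarAlgebra A] :
    A →⋆ₙₐ[ℂ] MaxTensor A ScalarAlgebra.{u} where
  toFun a := ofAlg (a ⊗ₜ[ℂ] 1)
  map_smul' c a := by rw [← TensorProduct.smul_tmul', map_smul]; rfl
  map_zero' := by rw [TensorProduct.zero_tmul, map_zero]
  map_add' a b := by rw [TensorProduct.add_tmul, map_add]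
  map_mul' a b := by rw [← map_mul, Algebra.TensorProduct.tmul_mul_tmul, one_mul]
  map_star' a := by rw [← map_star, TensorProduct.star_tmul, star_one]

theorem tmulOne_apply (a : A) : tmulOne A a = ofAlg (a ⊗ₜ[ℂ] 1) := rfl

/-- `*`-homomorphisms are contractive, and slicing with the character of `ℂ` recovers `a` without
increasing the norm. -/
theorem norm_tmulOne (a : A) : ‖tmulOne A a‖ = ‖a‖ := by
  refine le_antisymm (NonUnitalStarAlgHom.norm_apply_le _ a) ?_
  refine le_trans (le_of_eq ?_) (norm_map_ofAlg_le (sliceHom A scalarChar) _)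
  rw [sliceHom_tmul]
  change _ = ‖(1 : ℂ) • a‖
  rw [one_smul]

theorem tmulOne_injective : Function.Injective (tmulOne A) :=
  (AddMonoidHomClass.isometry_of_norm _ norm_tmulOne).injective

theorem tmulOne_slice (w : A ⊗[ℂ] ScalarAlgebra.{u}) :
    tmulOne A (sliceHom A scalarChar w) = ofAlg w := by
  induction w with
  | zero => simp
  | add x y hx hy => simp only [map_add, hx, hy]
  | tmul a f =>
    rw [sliceHom_tmul, tmulOne_apply, TensorProduct.smul_tmul]
    congr 2
    ext x
    exact mul_one _

/-- The range of an isometry from a complete space is closed, and this one contains the dense image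
of the algebraic tensor product. -/
theorem tmulOne_surjective : Function.Surjective (tmulOne A) := by
  have hc : IsClosed (Set.range (tmulOne A)) :=
    (AddMonoidHomClass.isometry_of_norm _ norm_tmulOne).isClosedEmbedding.isClosed_range
  have hd : Set.range (ofAlg : A ⊗[ℂ] ScalarAlgebra.{u} → _) ⊆ Set.range (tmulOne A) := by
    rintro _ ⟨w, rfl⟩
    exact ⟨_, tmulOne_slice w⟩
  intro x
  exact hc.closure_subset_iff.2 hd (denseRange_ofAlg x)

/-- `A ⊗ ℂ` is isomorphic to `A`. -/
def tmulOneEquiv (A : Type u) [NonUnitalCStarAlgebra A] :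
    A ≃⋆ₐ[ℂ] MaxTensor A ScalarAlgebra.{u} :=
  StarAlgEquiv.ofBijective (tmulOne A) ⟨tmulOne_injective, tmulOne_surjective⟩

theorem map_tmulOne (φ : A →⋆ₙₐ[ℂ] B) (a : A) :
    map φ (NonUnitalStarAlgHom.id ℂ ScalarAlgebra.{u}) (tmulOne A a) = tmulOne B (φ a) := by
  rw [tmulOne_apply, map_ofAlg]; rfl

/-! ### Elements of `A ⊗ C₀((0, 1])` are determined by their values -/

/-- Evaluation at a point, as a character. -/
def evalChar (t : ULift.{u} I) : IntervalAlgebra.{u} →⋆ₙₐ[ℂ] ℂ :=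
  scalarChar.comp (IntervalAlgebra.eval t)

@[simp]
theorem evalChar_apply (t : ULift.{u} I) (f : IntervalAlgebra.{u}) : evalChar t f = f t := rfl

/-- Under `A ≅ A ⊗ ℂ`, the map `id ⊗ ev_t` takes an algebraic tensor to its value at `t`. -/
theorem map_eval_ofAlg (t : ULift.{u} I) (w : A ⊗[ℂ] IntervalAlgebra.{u}) :
    map (NonUnitalStarAlgHom.id ℂ A) (IntervalAlgebra.eval t) (ofAlg w) =
      tmulOne A (sliceHom A (evalChar t) w) := by
  rw [map_ofAlg, ← tmulOne_slice]
  congr 1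
  induction w with
  | zero => simp
  | add x y hx hy => simp only [map_add, hx, hy]
  | tmul a f => simp; rfl

open IntervalAlgebra in
/-- The Bernstein approximation in the second variable. -/
def bernsteinApprox (n : ℕ) (w : A ⊗[ℂ] IntervalAlgebra.{u}) : A ⊗[ℂ] IntervalAlgebra.{u} :=
  ∑ k : Fin n, sliceHom A (evalChar (node k)) w ⊗ₜ[ℂ]
    (star (sqrtBernstein n k) * sqrtBernstein n k)

/-- By additivity in `w` it suffices to treat elementary tensors, where `‖a ⊗ f‖ ≤ ‖a‖ * ‖f‖`
reduces the claim to scalar functions. -/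
theorem tendsto_bernsteinApprox (w : A ⊗[ℂ] IntervalAlgebra.{u}) :
    Filter.Tendsto (fun n => ofAlg (bernsteinApprox n w)) Filter.atTop (nhds (ofAlg w)) := by
  induction w with
  | zero => simp [bernsteinApprox]
  | add x y hx hy =>
    simpa only [bernsteinApprox, map_add, TensorProduct.add_tmul, Finset.sum_add_distrib]
      using hx.add hy
  | tmul a f =>
    have hf := (IntervalAlgebra.tendsto_bernstein f)
    rw [tendsto_iff_norm_sub_tendsto_zero] at hf ⊢
    refine squeeze_zero (fun _ => norm_nonneg _) (fun n => ?_)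
      (by simpa using hf.const_mul ‖a‖)
    refine le_trans (le_of_eq ?_) (norm_ofAlg_tmul_le a _)
    rw [← map_sub, TensorProduct.tmul_sub, TensorProduct.tmul_sum]
    simp only [bernsteinApprox, sliceHom_tmul, evalChar_apply, TensorProduct.smul_tmul]

/-- With `a = r* r`, the tensor equals `(r ⊗ b)* (r ⊗ b)`. -/
theorem ofAlg_tmul_star_mul_self_nonneg [PartialOrder A] [StarOrderedRing A]
    [PartialOrder (MaxTensor A B)] [StarOrderedRing (MaxTensor A B)] {a : A} (ha : 0 ≤ a) (b : B) :
    0 ≤ ofAlg (a ⊗ₜ[ℂ] (star b * b)) := by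
  obtain ⟨r, rfl⟩ := CStarAlgebra.nonneg_iff_eq_star_mul_self.mp ha
  have h : (star r * r) ⊗ₜ[ℂ] (star b * b) = star (r ⊗ₜ[ℂ] b) * (r ⊗ₜ[ℂ] b) := by simp
  rw [h, map_mul, map_star]
  exact star_mul_self_nonneg _

/-- A self-adjoint element between `-q` and `q` has norm at most `3 * ‖q‖`. -/
theorem norm_le_three_mul {C : Type*} [NonUnitalCStarAlgebra C] [PartialOrder C]
    [StarOrderedRing C] {x q : C} (h1 : 0 ≤ q + x) (h2 : 0 ≤ q - x) : ‖x‖ ≤ 3 * ‖q‖ := by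
  -- Comparing `0 ≤ q + x ≤ 2q` costs a factor, which is harmless because the bound is applied with
  -- `‖q‖` of order `ε`.
  have h3 : q + x ≤ q + q := by
    rw [← sub_nonneg]; simpa using h2
  have h4 := CStarAlgebra.norm_le_norm_of_nonneg_of_le h1 h3
  calc ‖x‖ = ‖(q + x) - q‖ := by simp
    _ ≤ ‖q + x‖ + ‖q‖ := norm_sub_le _ _
    _ ≤ (‖q‖ + ‖q‖) + ‖q‖ := by gcongr; exact h4.trans (norm_add_le _ _)
    _ = 3 * ‖q‖ := by ring

/-- Taking real parts is contractive and fixes `y`, so an approximant of `y` may be taken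
self-adjoint. -/
theorem norm_sub_realPart_le {C : Type*} [NonUnitalCStarAlgebra C] {y : C} (hy : IsSelfAdjoint y)
    (x : C) : ‖y - (2⁻¹ : ℂ) • (x + star x)‖ ≤ ‖y - x‖ := by
  have h : y - (2⁻¹ : ℂ) • (x + star x) = (2⁻¹ : ℂ) • ((y - x) + star (y - x)) := by
    rw [star_sub, hy.star_eq]
    module
  have h1 := norm_add_le (y - x) (star (y - x))
  rw [norm_star] at h1
  rw [h, norm_smul, norm_inv, Complex.norm_ofNat]
  linarith

theorem norm_conj_le_mul {C : Type*} [NonUnitalCStarAlgebra C] (v x : C) :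
    ‖star v * x * v‖ ≤ ‖x‖ * ‖v‖ ^ 2 := by
  calc ‖star v * x * v‖ ≤ ‖star v‖ * ‖x‖ * ‖v‖ := norm_mul₃_le
    _ = ‖x‖ * ‖v‖ ^ 2 := by rw [norm_star]; ring

open IntervalAlgebra in
-- Each value `c` of `w` is self-adjoint with norm at most `ε`, so `d* c d` lies between `-ε d* d`
-- and `ε d* d`. Tensoring with squares and summing preserves these inequalities, and
-- `norm_le_three_mul` turns them into a norm bound that is independent of `n`.
theorem norm_conj_bernsteinApprox_le (n : ℕ) {w : A ⊗[ℂ] IntervalAlgebra.{u}}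
    (hw : IsSelfAdjoint w) {ε : ℝ} (hε : ∀ t, ‖sliceHom A (evalChar t) w‖ ≤ ε) (d : A)
    (e : IntervalAlgebra.{u}) :
    ‖ofAlg (star (d ⊗ₜ[ℂ] e) * bernsteinApprox n w * (d ⊗ₜ[ℂ] e))‖ ≤
      3 * (ε * (‖d‖ ^ 2 * ‖e‖ ^ 2)) := by
  let _ : PartialOrder A := CStarAlgebra.spectralOrder _
  let _ : StarOrderedRing A := CStarAlgebra.spectralOrderedRing _
  let _ : PartialOrder (MaxTensor A IntervalAlgebra.{u}) := CStarAlgebra.spectralOrder _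
  let _ : StarOrderedRing (MaxTensor A IntervalAlgebra.{u}) := CStarAlgebra.spectralOrderedRing _
  have hε0 : 0 ≤ ε := (norm_nonneg _).trans (hε 0)
  let c : Fin n → A := fun k => sliceHom A (evalChar (node k)) w
  let s : Fin n → IntervalAlgebra.{u} := fun k => sqrtBernstein n k * e
  have hs (k : Fin n) : star e * (star (sqrtBernstein n k) * sqrtBernstein n k) * e =
      star (s k) * s k := by simp only [s, star_mul, mul_assoc]
  have hc (k : Fin n) : IsSelfAdjoint (c k) := hw.map _
  have hX : ofAlg (star (d ⊗ₜ[ℂ] e) * bernsteinApprox n w * (d ⊗ₜ[ℂ] e)) =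
      ∑ k, ofAlg ((star d * c k * d) ⊗ₜ[ℂ] (star (s k) * s k)) := by
    simp only [bernsteinApprox, Finset.mul_sum, Finset.sum_mul, map_sum, ← hs,
      TensorProduct.star_tmul, Algebra.TensorProduct.tmul_mul_tmul, c]
  let q : MaxTensor A IntervalAlgebra.{u} :=
    ∑ k, ofAlg ((ε • (star d * d)) ⊗ₜ[ℂ] (star (s k) * s k))
  have hq : ‖q‖ ≤ ε * (‖d‖ ^ 2 * ‖e‖ ^ 2) := by
    -- The first factor of the majorant does not depend on `k`, so the sum collapses to one
    -- elementary tensor and no factor `n` appears.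
    have : q = ofAlg ((ε • (star d * d)) ⊗ₜ[ℂ]
        (star e * (∑ k : Fin n, star (sqrtBernstein n k) * sqrtBernstein n k) * e)) := by
      simp only [q, Finset.mul_sum, Finset.sum_mul, hs, TensorProduct.tmul_sum, map_sum]
    rw [this]
    refine (norm_ofAlg_tmul_le _ _).trans ?_
    rw [norm_smul, Real.norm_of_nonneg hε0, CStarRing.norm_star_mul_self, mul_assoc, ← sq]
    gcongr
    refine (norm_mul_le _ _).trans ?_
    rw [sq]
    gcongr
    refine (norm_mul_le _ _).trans ?_
    rw [norm_star]
    exact mul_le_of_le_one_right (norm_nonneg _) (norm_sum_bernstein_le n)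
  have hle (x : A) (hx : IsSelfAdjoint x) (hxε : ‖x‖ ≤ ε) :
      0 ≤ ε • (star d * d) - star d * x * d := by
    rw [sub_nonneg]
    exact (CStarAlgebra.star_left_conjugate_le_norm_smul hx).trans
      (smul_le_smul_of_nonneg_right hxε (star_mul_self_nonneg d))
  rw [hX]
  refine (norm_le_three_mul (q := q) ?_ ?_).trans (by gcongr)
  · simp only [q, ← Finset.sum_add_distrib, ← map_add, ← TensorProduct.add_tmul]
    refine Finset.sum_nonneg fun k _ => ofAlg_tmul_star_mul_self_nonneg ?_ _
    -- The lower bound is the upper bound for `-c k`.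
    simpa using hle (-c k) (hc k).neg (by rw [norm_neg]; exact hε _)
  · simp only [q, ← Finset.sum_sub_distrib, ← map_sub, ← TensorProduct.sub_tmul]
    exact Finset.sum_nonneg fun k _ => ofAlg_tmul_star_mul_self_nonneg (hle _ (hc k) (hε _)) _

theorem norm_conj_le {w : A ⊗[ℂ] IntervalAlgebra.{u}} (hw : IsSelfAdjoint w) {ε : ℝ}
    (hε : ∀ t, ‖sliceHom A (evalChar t) w‖ ≤ ε) (d : A) (e : IntervalAlgebra.{u}) :
    ‖star (ofAlg (d ⊗ₜ[ℂ] e)) * ofAlg w * ofAlg (d ⊗ₜ[ℂ] e)‖ ≤ 3 * (ε * (‖d‖ ^ 2 * ‖e‖ ^ 2)) := by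
  refine le_of_tendsto (((tendsto_bernsteinApprox w).const_mul _).mul_const _).norm
    (Filter.Eventually.of_forall fun n => ?_)
  rw [← map_star, ← map_mul, ← map_mul]
  exact norm_conj_bernsteinApprox_le n hw hε d e

/-- By linearity, density and continuity `z` annihilates everything, in particular `star z`, so `z
z* = 0`. -/
theorem eq_zero_of_mul_ofAlg_tmul {z : MaxTensor A B} (h : ∀ a b, z * ofAlg (a ⊗ₜ[ℂ] b) = 0) :
    z = 0 := by
  have h1 (w : A ⊗[ℂ] B) : z * ofAlg w = 0 := by
    induction w with
    | zero => simp
    | add x y hx hy => rw [map_add, mul_add, hx, hy, add_zero]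
    | tmul a b => exact h a b
  have h2 : (fun x => z * x) = fun _ => 0 :=
    denseRange_ofAlg.equalizer (by fun_prop) (by fun_prop) (funext h1)
  exact CStarRing.mul_star_self_eq_zero_iff z |>.1 (congrFun h2 (star z))

/-- An element of `A ⊗ C₀((0, 1])` all of whose values vanish is zero. -/
theorem eq_zero_of_map_eval {z : MaxTensor A IntervalAlgebra.{u}}
    (hz : ∀ t, map (NonUnitalStarAlgHom.id ℂ A) (IntervalAlgebra.eval t) z = 0) : z = 0 := by
  refine eq_zero_of_mul_ofAlg_tmul fun d e => ?_
  set v := ofAlg (d ⊗ₜ[ℂ] e) with hv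
  -- Passing to `z* z` supplies the self-adjointness that the order estimate needs; its values still
  -- vanish, and `v* y v = (z v)* (z v)`.
  set y := star z * z with hy
  have hys : IsSelfAdjoint y := .star_mul_self z
  suffices h : ∀ ε : ℝ, 0 < ε →
      ‖star v * y * v‖ ≤ ε * (3 * (‖d‖ ^ 2 * ‖e‖ ^ 2) + ‖v‖ ^ 2) by
    have h0 : ‖star v * y * v‖ ≤ 0 := by
      refine ge_of_tendsto (x := nhdsWithin (0 : ℝ) (Set.Ioi 0))
        (f := fun ε : ℝ => ε * (3 * (‖d‖ ^ 2 * ‖e‖ ^ 2) + ‖v‖ ^ 2)) ?_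
        (Filter.eventually_of_mem self_mem_nhdsWithin h)
      refine tendsto_nhdsWithin_of_tendsto_nhds ?_
      exact Continuous.tendsto' (by fun_prop) _ _ (by simp)
    rw [← CStarRing.star_mul_self_eq_zero_iff, ← norm_le_zero_iff]
    simpa only [hy, star_mul, mul_assoc] using h0
  intro ε hε
  obtain ⟨w₀, hw₀⟩ := Metric.denseRange_iff.1 denseRange_ofAlg y ε hε
  rw [dist_eq_norm] at hw₀
  let w : A ⊗[ℂ] IntervalAlgebra.{u} := (2⁻¹ : ℂ) • (w₀ + star w₀)
  have hws : IsSelfAdjoint w := by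
    simp [w, IsSelfAdjoint, add_comm]
  have hwy : ‖y - ofAlg w‖ ≤ ε := by
    have h := norm_sub_realPart_le hys (ofAlg w₀)
    rw [← map_star, ← map_add, ← map_smul] at h
    exact h.trans hw₀.le
  -- Since `y` vanishes at `t`, the value of `w` there is, up to sign, that of `y - w`, and
  -- evaluation is contractive.
  have hval (t : ULift.{u} I) : ‖sliceHom A (evalChar t) w‖ ≤ ε := by
    rw [← norm_tmulOne, ← map_eval_ofAlg]
    have hy0 : map (NonUnitalStarAlgHom.id ℂ A) (IntervalAlgebra.eval t) y = 0 := by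
      rw [hy, map_mul, hz, mul_zero]
    calc _ = ‖map (NonUnitalStarAlgHom.id ℂ A) (IntervalAlgebra.eval t) (y - ofAlg w)‖ := by
          rw [map_sub, hy0, zero_sub, norm_neg]
      _ ≤ ‖y - ofAlg w‖ := NonUnitalStarAlgHom.norm_apply_le _ _
      _ ≤ ε := hwy
  have h1 := norm_conj_le hws hval d e
  rw [← hv] at h1
  calc ‖star v * y * v‖ = ‖star v * ofAlg w * v + star v * (y - ofAlg w) * v‖ := by
        rw [← add_mul, ← mul_add, add_sub_cancel]
    _ ≤ ‖star v * ofAlg w * v‖ + ‖star v * (y - ofAlg w) * v‖ := norm_add_le _ _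
    _ ≤ 3 * (ε * (‖d‖ ^ 2 * ‖e‖ ^ 2)) + ε * ‖v‖ ^ 2 := by
        gcongr
        exact (norm_conj_le_mul _ _).trans (by gcongr)
    _ = ε * (3 * (‖d‖ ^ 2 * ‖e‖ ^ 2) + ‖v‖ ^ 2) := by ring

end MaxTensor

/-! ### Natural transformations between tensor functors -/

namespace CStarAlgCat

variable {A A' : CStarAlgCat.{u}}

/-- The components of a natural transformation between tensor functors. -/
def component (Φ : tensorEmbedding.obj A ⟶ tensorEmbedding.obj A') (B : Type u)
    [NonUnitalCStarAlgebra B] : MaxTensor A B →⋆ₙₐ[ℂ] MaxTensor A' B :=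
  (Φ.app ⟨B⟩).hom

/-- The component at `ℂ` of a natural transformation, as a `*`-homomorphism `A → A'`. -/
def scalarComponent (Φ : tensorEmbedding.obj A ⟶ tensorEmbedding.obj A') : A →⋆ₙₐ[ℂ] A' :=
  ((MaxTensor.tmulOneEquiv A').symm : MaxTensor A' ScalarAlgebra.{u} →⋆ₙₐ[ℂ] A').comp
    ((component Φ ScalarAlgebra.{u}).comp (MaxTensor.tmulOne A))

theorem component_map (Φ : tensorEmbedding.obj A ⟶ tensorEmbedding.obj A') {B B' : Type u}
    [NonUnitalCStarAlgebra B] [NonUnitalCStarAlgebra B'] (ψ : B →⋆ₙₐ[ℂ] B') (x : MaxTensor A B) :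
    component Φ B' (MaxTensor.map (NonUnitalStarAlgHom.id ℂ A) ψ x) =
      MaxTensor.map (NonUnitalStarAlgHom.id ℂ A') ψ (component Φ B x) :=
  DFunLike.congr_fun (congrArg Hom.hom (Φ.naturality (X := ⟨B⟩) (Y := ⟨B'⟩) ⟨ψ⟩)) x

theorem component_tmulOne (Φ : tensorEmbedding.obj A ⟶ tensorEmbedding.obj A') (a : A) :
    component Φ ScalarAlgebra.{u} (MaxTensor.tmulOne A a) =
      MaxTensor.tmulOne A' (scalarComponent Φ a) :=
  ((MaxTensor.tmulOneEquiv A').apply_symm_apply _).symm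

/-- Naturality along `ev_t` gives both sides the value `f t • scalarComponent Φ a` at each `t`. -/
theorem component_intervalAlgebra (Φ : tensorEmbedding.obj A ⟶ tensorEmbedding.obj A') (a : A)
    (f : IntervalAlgebra.{u}) :
    component Φ IntervalAlgebra.{u} (MaxTensor.ofAlg (a ⊗ₜ[ℂ] f)) =
      MaxTensor.ofAlg (scalarComponent Φ a ⊗ₜ[ℂ] f) := by
  rw [← sub_eq_zero]
  refine MaxTensor.eq_zero_of_map_eval fun t => ?_
  rw [map_sub, MaxTensor.map_eval_ofAlg, ← component_map, MaxTensor.map_eval_ofAlg,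
    component_tmulOne, MaxTensor.sliceHom_tmul, MaxTensor.sliceHom_tmul, map_smul, sub_self]

/-- Both sides are linear in `b`, so `b` may be taken a positive contraction; naturality along the
homomorphism sending `coord` to `b` then transports the identity from `C₀((0, 1])`. -/
theorem component_ofAlg_tmul (Φ : tensorEmbedding.obj A ⟶ tensorEmbedding.obj A') {B : Type u}
    [NonUnitalCStarAlgebra B] (a : A) (b : B) :
    component Φ B (MaxTensor.ofAlg (a ⊗ₜ[ℂ] b)) =
      MaxTensor.ofAlg (scalarComponent Φ a ⊗ₜ[ℂ] b) := by
  let _ : PartialOrder B := CStarAlgebra.spectralOrder _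
  let _ : StarOrderedRing B := CStarAlgebra.spectralOrderedRing _
  have hb : b ∈ Submodule.span ℂ ({x : B | 0 ≤ x} ∩ Metric.closedBall 0 1) := by
    rw [CStarAlgebra.span_nonneg_inter_unitClosedBall]; trivial
  induction hb using Submodule.span_induction with
  | mem b hb =>
    obtain ⟨ψ, rfl⟩ := IntervalAlgebra.exists_hom_coord_eq hb.1 (by simpa using hb.2)
    have h := component_map Φ ψ (MaxTensor.ofAlg (a ⊗ₜ[ℂ] IntervalAlgebra.coord))
    rw [component_intervalAlgebra, MaxTensor.map_ofAlg, MaxTensor.map_ofAlg] at h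
    exact h
  | zero => simp
  | add x y _ _ hx hy => simp only [TensorProduct.tmul_add, map_add, hx, hy]
  | smul c x _ hx => simp only [TensorProduct.tmul_smul, map_smul, hx]

theorem component_eq_map (Φ : tensorEmbedding.obj A ⟶ tensorEmbedding.obj A') (B : Type u)
    [NonUnitalCStarAlgebra B] :
    component Φ B = MaxTensor.map (scalarComponent Φ) (NonUnitalStarAlgHom.id ℂ B) := by
  refine MaxTensor.hom_ext ?_ (MaxTensor.continuous_map _ _) fun a b => ?_
  · exact AddMonoidHomClass.continuous_of_bound _ 1 fun x => by
      rw [one_mul]; exact NonUnitalStarAlgHom.norm_apply_le _ x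
  · rw [MaxTensor.map_ofAlg]
    exact component_ofAlg_tmul Φ a b

theorem app_hom_eq_map (Φ : tensorEmbedding.obj A ⟶ tensorEmbedding.obj A')
    (B : CStarAlgCat.{u}) :
    (Φ.app B).hom = MaxTensor.map (scalarComponent Φ) (NonUnitalStarAlgHom.id ℂ B) :=
  component_eq_map Φ B

/-- Faithfulness and uniqueness both come from here: the component at `ℂ` recovers `φ`, as `a ↦ a ⊗
1` is injective. -/
theorem eq_of_map_scalarAlgebra_eq {φ φ' : A →⋆ₙₐ[ℂ] A'}
    (h : MaxTensor.map φ (NonUnitalStarAlgHom.id ℂ ScalarAlgebra.{u}) =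
      MaxTensor.map φ' (NonUnitalStarAlgHom.id ℂ ScalarAlgebra.{u})) : φ = φ' := by
  ext a
  apply MaxTensor.tmulOne_injective
  rw [← MaxTensor.map_tmulOne, ← MaxTensor.map_tmulOne, h]

end CStarAlgCat

end

theorem theorem3p19 :
    CStarAlgCat.tensorEmbedding.{u}.Full ∧ CStarAlgCat.tensorEmbedding.{u}.Faithful ∧
      ∀ (A A' : CStarAlgCat.{u})
        (Φ : CStarAlgCat.tensorEmbedding.obj A ⟶ CStarAlgCat.tensorEmbedding.obj A'),
        ∃! φ : A →⋆ₙₐ[ℂ] A', ∀ B : CStarAlgCat.{u},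
          (Φ.app B).hom = MaxTensor.map φ (NonUnitalStarAlgHom.id ℂ B) := by
  refine ⟨⟨fun Φ => ⟨⟨CStarAlgCat.scalarComponent Φ⟩, ?_⟩⟩, ⟨fun {A A' φ φ'} h => ?_⟩,
    fun A A' Φ => ⟨_, CStarAlgCat.app_hom_eq_map Φ, fun φ hφ => ?_⟩⟩
  · ext B : 2
    exact CStarAlgCat.hom_ext (CStarAlgCat.app_hom_eq_map Φ B).symm
  · exact CStarAlgCat.hom_ext (CStarAlgCat.eq_of_map_scalarAlgebra_eq
      (congrArg CStarAlgCat.Hom.hom (congrArg (fun η => η.app ⟨ScalarAlgebra.{u}⟩) h)))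
  · exact CStarAlgCat.eq_of_map_scalarAlgebra_eq
      ((hφ ⟨ScalarAlgebra.{u}⟩).symm.trans (CStarAlgCat.app_hom_eq_map Φ _))
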